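/- Let $G_1, G_2$ be nontrivial groups which are not both isomorphic to $\mathbb{Z}/2\mathbb{Z}$, let $G = G_1 * G_2$ be their free product, and let $\mathbb{F}_\omega$ be the free group with basis $e_1, e_2, e_3, \ldots$. Let $\varphi_{\mathrm{NE}}(x,y)$ be the first-order formula $$\forall u\,\forall v\;\bigl([u,v] \neq 1 \rightarrow xy \neq u^5 v^4\bigr)$$ in the language of groups. Then for any pair $(a,b)$ of distinct elements which is part of some basis of $\mathbb{F}_\omega$ we have $$G * \mathbb{F}_\omega \models \varphi_{\mathrm{NE}}(a,b).$$ Moreover, $e_1 \neq u^5 v^4$ for all non-commuting elements $u, v$ of $G * \mathbb{F}_\omega$. -/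

import Mathlib

open FirstOrder FirstOrder.Language
open scoped commutatorElement

namespace NonEq

/-- Function symbols of the first-order language of groups: a constant `1`, a unary symbol for
inversion and a binary symbol for multiplication. -/
inductive GroupFunc : ℕ → Type
  | one : GroupFunc 0
  | inv : GroupFunc 1
  | mul : GroupFunc 2

/-- The first-order language of groups (no relation symbols besides equality). -/
def groupLang : Language where
  Functions := GroupFunc
  Relations := fun _ => Empty

/-- Every group is a structure for the language of groups in the usual way. -/
instance groupStructure (Γ : Type*) [Group Γ] : groupLang.Structure Γ where
  funMap {n} (f : GroupFunc n) :=
    match n, f with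
    | _, .one => fun _ => 1
    | _, .inv => fun x => (x 0)⁻¹
    | _, .mul => fun x => x 0 * x 1
  RelMap {_} r := Empty.elim r

/-- The constant term `1`. -/
def tOne {α : Type*} : groupLang.Term α := Term.func (l := 0) GroupFunc.one ![]

/-- The term `t⁻¹`. -/
def tInv {α : Type*} (t : groupLang.Term α) : groupLang.Term α :=
  Term.func (l := 1) GroupFunc.inv ![t]

/-- The term `s * t`. -/
def tMul {α : Type*} (s t : groupLang.Term α) : groupLang.Term α :=
  Term.func (l := 2) GroupFunc.mul ![s, t]

/-- The term `t ^ n`, that is `1 * t * ⋯ * t` with `n` factors `t`. -/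
def tPow {α : Type*} (t : groupLang.Term α) : ℕ → groupLang.Term α
  | 0 => tOne
  | n + 1 => tMul (tPow t n) t

/-- The term `[s, t] = s * t * s⁻¹ * t⁻¹`. -/
def tComm {α : Type*} (s t : groupLang.Term α) : groupLang.Term α :=
  tMul (tMul (tMul s t) (tInv s)) (tInv t)

/-- The first-order formula `φ_NE(x, y) := ∀ u v, ([u, v] ≠ 1 → x * y ≠ u ^ 5 * v ^ 4)` in the
language of groups; its free variables `x, y` are indexed by `0, 1 : Fin 2`, and `u, v` are the
bound variables `&0, &1`. -/
def phiNE : groupLang.Formula (Fin 2) :=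
  let x : groupLang.Term (Fin 2 ⊕ Fin 2) := Term.var (Sum.inl 0)
  let y : groupLang.Term (Fin 2 ⊕ Fin 2) := Term.var (Sum.inl 1)
  let u : groupLang.Term (Fin 2 ⊕ Fin 2) := &0
  let v : groupLang.Term (Fin 2 ⊕ Fin 2) := &1
  ((Term.bdEqual (tComm u v) tOne).not.imp
    (Term.bdEqual (tMul x y) (tMul (tPow u 5) (tPow v 4))).not).all.all

section Realize

variable {Γ : Type*} [Group Γ] {α : Type*} (w : α → Γ)

@[simp] lemma realize_tOne : (tOne : groupLang.Term α).realize w = 1 := rfl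

@[simp] lemma realize_tInv (t : groupLang.Term α) :
    (tInv t).realize w = (t.realize w)⁻¹ := rfl

@[simp] lemma realize_tMul (s t : groupLang.Term α) :
    (tMul s t).realize w = s.realize w * t.realize w := rfl

@[simp] lemma realize_tPow (t : groupLang.Term α) (n : ℕ) :
    (tPow t n).realize w = (t.realize w) ^ n := by
  induction n with
  | zero => simp [tPow]
  | succ n ih => simp [tPow, ih, pow_succ]

@[simp] lemma realize_tComm (s t : groupLang.Term α) :
    (tComm s t).realize w = ⁅s.realize w, t.realize w⁆ := by
  simp [tComm, commutatorElement_def]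

end Realize

/-- The formula `φ_NE` means what it should in every group. -/
lemma realize_phiNE {Γ : Type*} [Group Γ] (a b : Γ) :
    phiNE.Realize ![a, b] ↔ ∀ u v : Γ, ⁅u, v⁆ ≠ 1 → a * b ≠ u ^ 5 * v ^ 4 := by
  simp [phiNE, Formula.Realize, Fin.snoc]

/-- `F_ω`, the free group of rank `ω`, on the basis `e_1, e_2, …`. -/
abbrev FOmega : Type := FreeGroup ℕ

/-- The first element `e_1` of the fixed basis `e_1, e_2, …` of `F_ω`
(the basis is indexed from `0` here). -/
def e₁ : FOmega := FreeGroup.of 0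

/-- The pair `(a, b)` is part of some basis of the free group `F`: `a` and `b` are two members,
with different indices, of one basis. -/
def IsPartOfBasis {F : Type*} [Group F] (a b : F) : Prop :=
  ∃ (S : Set F) (B : FreeGroupBasis S F), (∀ s : S, B s = (s : F)) ∧ a ∈ S ∧ b ∈ S ∧ a ≠ b

/-- Any two members with different indices of an indexed basis are part of a basis. -/
lemma IsPartOfBasis.of_basis {F : Type*} [Group F] {ι : Type*} (B : FreeGroupBasis ι F)
    {i j : ι} (hij : i ≠ j) : IsPartOfBasis (B i) (B j) := by
  refine ⟨Set.range B, B.reindex (Equiv.ofInjective B B.injective), ?_, ⟨i, rfl⟩, ⟨j, rfl⟩,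
    fun h => hij (B.injective h)⟩
  rintro ⟨_, k, rfl⟩
  rw [FreeGroupBasis.reindex_apply]
  congr 1
  exact Equiv.ofInjective_symm_apply B.injective k

end NonEq

/-! Write `Γ` for the whole group and `e` for `a * b` or `e₁`. Replacing one basis element by its
product with a word in the others again gives a basis, so `e` is primitive. Hence `Γ` embeds in `Γ *
⟨t⟩` with `e ↦ t` (`inr_basis_mul_ne`, `ne_pow_mul_pow`), and it suffices to treat `t` in a free
product `H * ⟨t⟩`.

That group acts on its Bass–Serre tree, whose vertices are the cosets of `H` and whose edge
stabilisers are trivial. Let `τ` be the exponent sum of `t`. If `t = u ^ 5 * v ^ 4`, then `5 τ(u) +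
4 τ(v) = 1`, so neither `τ(u)` nor `τ(v)` is zero and both elements translate along axes. The
vertices of `u⁻⁵` and `v⁴` are adjacent, so the geodesics to them from the base vertex agree up to
one edge. Each consists of an approach to an axis, five (resp. four) periods along it, and a
translate of the approach run backwards (`exists_axis`).

Comparing the two descriptions, either the axes share more than the sum of the two translation
lengths, so the commutator fixes an edge and is trivial (`commute_of_overlap`), or a full period of
one axis lies in the approach to the other and reappears reversed, which forces its `τ` to vanish
(`false_of_reversed`). -/

/-- A left-invariant pseudometric on a group coming from an action on a simplicial tree with
trivial edge stabilisers and one orbit of vertices, together with a homomorphism to `ℤ` which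
is trivial on vertex stabilisers and computes the parity of distances. -/
structure TreeMetric (Γ : Type*) [Group Γ] where
  /-- the distance between the translates of the base vertex by two elements -/
  d : Γ → Γ → ℕ
  /-- the homomorphism to `ℤ` -/
  τ : Γ → ℤ
  d_self : ∀ x, d x x = 0
  d_comm : ∀ x y, d x y = d y x
  d_mul_left : ∀ g x y, d (g * x) (g * y) = d x y
  four_point : ∀ x y z w, d x z + d y w ≤ d x y + d z w ∨ d x z + d y w ≤ d x w + d y z
  exists_between : ∀ x y i, i ≤ d x y → ∃ z, d x z = i ∧ i + d z y = d x y
  eq_one : ∀ g x y, d (g * x) x = 0 → d (g * y) y = 0 → d x y ≠ 0 → g = 1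
  τ_mul : ∀ x y, τ (x * y) = τ x + τ y
  parity : ∀ x y, ((d x y : ℤ) - (τ x - τ y)) % 2 = 0
  τ_eq : ∀ x y, d x y = 0 → τ x = τ y

/-! ### Axes of translations and their overlaps. -/

namespace TreeMetric

variable {Γ : Type*} [Group Γ] (M : TreeMetric Γ)

lemma triangle (x y z : Γ) : M.d x z ≤ M.d x y + M.d y z := by
  have h := M.four_point x y z y
  rw [M.d_self, M.d_comm z y] at h
  omega

lemma τ_one : M.τ 1 = 0 := by
  have := M.τ_mul 1 1
  simp at this; exact this

lemma τ_pow (g : Γ) (n : ℕ) : M.τ (g ^ n) = n * M.τ g := by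
  induction n with
  | zero => simp [M.τ_one]
  | succ n ih => rw [pow_succ, M.τ_mul, ih]; push_cast; ring

lemma τ_inv (g : Γ) : M.τ g⁻¹ = -M.τ g := by
  have := M.τ_mul g⁻¹ g
  rw [inv_mul_cancel, M.τ_one] at this
  omega

lemma d_inv_mul_self (g w : Γ) : M.d w (g⁻¹ * w) = M.d w (g * w) := by
  rw [← M.d_mul_left g, mul_inv_cancel_left, M.d_comm]

/-- If `z` is a point of minimal displacement `L` nearest to the base point, then the geodesic
from the base point to `g * z` passes through `z`. -/
lemma d_one_mul_of_min {g z : Γ} {L : ℕ} (hL : 0 < L) (hz : M.d z (g * z) = L)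
    (hmin : ∀ w, L ≤ M.d w (g * w))
    (hnear : ∀ w, M.d w (g * w) = L → M.d 1 z ≤ M.d 1 w) :
    M.d 1 (g * z) = M.d 1 z + L := by
  by_contra hne
  have htri := M.triangle 1 z (g * z)
  have p1 := M.parity 1 (g * z)
  have p2 := M.parity 1 z
  have p3 := M.parity z (g * z)
  -- By parity the defect is at least 2, so the geodesics from `z` to `1` and to `g * z` share their
  -- first edge. Its end `w` is also minimally displaced, yet closer to `1`.
  obtain ⟨w, hw1, hw2⟩ := M.exists_between z (g * z) 1 (by omega)
  have h4 := M.four_point w z 1 (g * z)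
  have hgw : M.d (g * z) (g * w) = 1 := by rw [M.d_mul_left, hw1]
  have h5 := M.triangle w (g * z) (g * w)
  have h6 := hmin w
  have h7 := hnear w (by omega)
  rw [M.d_comm w z, M.d_comm w 1, M.d_comm z 1] at h4
  omega

/-- A point of minimal displacement is moved along a geodesic by an element with `τ g ≠ 0`. -/
lemma d_sq_of_min {g z : Γ} {L : ℕ} (hτ : M.τ g ≠ 0) (hz : M.d z (g * z) = L)
    (hmin : ∀ w, L ≤ M.d w (g * w)) : 0 < L ∧ M.d z (g * (g * z)) = 2 * L := by
  have hL : 0 < L := by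
    rcases Nat.eq_zero_or_pos L with h | h
    · have := M.τ_eq _ _ (hz.trans h)
      rw [M.τ_mul] at this
      omega
    · exact h
  refine ⟨hL, ?_⟩
  by_contra hne
  have hz' : M.d (g * z) (g * (g * z)) = L := by rw [M.d_mul_left, hz]
  have htri := M.triangle z (g * z) (g * (g * z))
  have p1 := M.parity z (g * (g * z))
  have p2 := M.parity z (g * z)
  have p3 := M.parity (g * z) (g * (g * z))
  -- If the path folds at `g * z`, it does so along the edge from `g * z` to `g * w`; for `L > 1`
  -- this makes the displacement of `w` less than `L`.
  obtain ⟨w, hw1, hw2⟩ := M.exists_between z (g * z) 1 (by omega)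
  have hgw1 : M.d (g * z) (g * w) = 1 := by rw [M.d_mul_left, hw1]
  have hgw2 : 1 + M.d (g * w) (g * (g * z)) = L := by rw [M.d_mul_left, hw2, hz]
  have h1 := M.four_point (g * w) (g * z) z (g * (g * z))
  have h2 := M.four_point w z (g * w) (g * z)
  have h3 := hmin w
  rw [M.d_comm (g * w) (g * z), M.d_comm (g * w) z, M.d_comm (g * z) z] at h1
  rw [M.d_comm w z, M.d_comm (g * w) (g * z)] at h2
  rcases Nat.lt_or_ge 1 L with hL1 | hL1
  · omega
  -- For `L = 1` a fold means that `g` inverts an edge, so `g ^ 2` fixes a vertex and `τ g = 0`.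
  · have hzero : M.d z (g * (g * z)) = 0 := by omega
    have := M.τ_eq _ _ hzero
    rw [M.τ_mul, M.τ_mul] at this
    omega

/-- The axis of an element `g` with `τ g ≠ 0`: the point `z` of the axis nearest to the base
point, and the translation length `L`. -/
lemma exists_nearest_axis_point (g : Γ) (hτ : M.τ g ≠ 0) : ∃ (z : Γ) (L : ℕ), 0 < L ∧
    (∀ n : ℕ, M.d 1 (g ^ n * z) = M.d 1 z + n * L) ∧
    (∀ n : ℕ, 0 < n → M.d z (g ^ n) = M.d 1 z + n * L) ∧
    (∀ n : ℕ, 0 < n → M.d 1 (g ^ n) = n * L + 2 * M.d 1 z) := by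
  obtain ⟨z₀, hz₀⟩ : ∃ z₀, ∀ w, M.d z₀ (g * z₀) ≤ M.d w (g * w) :=
    ⟨Function.argmin (fun w => M.d w (g * w)),
      fun w => Function.argmin_le (fun w => M.d w (g * w)) w⟩
  set L := M.d z₀ (g * z₀) with hLdef
  obtain ⟨z, hz, hnear⟩ : ∃ z, M.d z (g * z) = L ∧
      ∀ w, M.d w (g * w) = L → M.d 1 z ≤ M.d 1 w := by
    have hne : {w | M.d w (g * w) = L}.Nonempty := ⟨z₀, rfl⟩
    exact ⟨Function.argminOn (M.d 1) _ hne, Function.argminOn_mem (M.d 1) _ hne,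
      fun w hw => Function.argminOn_le (M.d 1) _ hw⟩
  obtain ⟨hL, hsq⟩ := M.d_sq_of_min hτ hz hz₀
  have hfwd := M.d_one_mul_of_min hL hz hz₀ hnear
  have hbwd : M.d 1 (g⁻¹ * z) = M.d 1 z + L :=
    M.d_one_mul_of_min hL (by rw [M.d_inv_mul_self, hz])
      (fun w => by rw [M.d_inv_mul_self]; exact hz₀ w)
      (fun w hw => hnear w (by rwa [M.d_inv_mul_self] at hw))
  -- Translating by `g` turns the statement about `g⁻¹` into one about how the geodesic to `g`
  -- leaves the axis.
  have hbwd' : M.d z g = M.d 1 z + L := by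
    rw [← M.d_mul_left g, mul_inv_cancel_left, mul_one, M.d_comm] at hbwd
    exact hbwd
  have hstep : ∀ n : ℕ, M.d (g ^ n * z) (g ^ (n + 1) * z) = L := fun n => by
    rw [pow_succ, mul_assoc, M.d_mul_left, hz]
  have hstep2 : ∀ n : ℕ, M.d (g ^ n * z) (g ^ (n + 2) * z) = 2 * L := fun n => by
    rw [pow_add, mul_assoc, M.d_mul_left, pow_two, mul_assoc, hsq]
  have hchain : ∀ p : Γ, M.d p (g * z) = M.d p z + L → ∀ n : ℕ,
      M.d p (g ^ n * z) = M.d p z + n * L ∧ M.d p (g ^ (n + 1) * z) = M.d p z + n * L + L := by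
    intro p hp n
    induction n with
    | zero => simpa using hp
    | succ n ih =>
      have h4 := M.four_point p (g ^ n * z) (g ^ (n + 1) * z) (g ^ (n + 2) * z)
      have h1 := hstep n
      have h2 := hstep (n + 1)
      have h3 := hstep2 n
      have htri := M.triangle p (g ^ (n + 1) * z) (g ^ (n + 2) * z)
      rw [Nat.succ_mul]
      refine ⟨by omega, ?_⟩
      rw [show n + 1 + 1 = n + 2 from rfl] at *
      omega
  have hone := fun n => (hchain 1 hfwd n).1
  have hend : ∀ n : ℕ, M.d (g ^ n * z) (g ^ (n + 1)) = M.d 1 z + L := fun n => by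
    rw [pow_succ, M.d_mul_left, hbwd']
  have hend0 : ∀ n : ℕ, M.d (g ^ n * z) (g ^ n) = M.d 1 z := fun n => by
    conv_lhs => rw [← mul_one (g ^ n), mul_assoc, one_mul, M.d_mul_left, M.d_comm]
  have hlast : ∀ p : Γ, M.d p (g * z) = M.d p z + L → ∀ n : ℕ,
      M.d p (g ^ (n + 1)) = M.d p z + (n + 1) * L + M.d 1 z := by
    intro p hp n
    have h4 := M.four_point p (g ^ n * z) (g ^ (n + 1) * z) (g ^ (n + 1))
    have h1 := hstep n
    have h2 := hend n
    have h3 := hend0 (n + 1)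
    have h5 := hchain p hp n
    have htri := M.triangle p (g ^ (n + 1) * z) (g ^ (n + 1))
    rw [Nat.succ_mul]
    omega
  refine ⟨z, L, hL, hone, fun n hn => ?_, fun n hn => ?_⟩
  · obtain ⟨m, rfl⟩ := Nat.exists_eq_succ_of_ne_zero hn.ne'
    have := hlast z (by simp [M.d_self, hz]) m
    rw [M.d_self] at this
    rw [this, Nat.succ_eq_add_one]; ring
  · obtain ⟨m, rfl⟩ := Nat.exists_eq_succ_of_ne_zero hn.ne'
    rw [hlast 1 hfwd m, Nat.succ_eq_add_one]; ring

/-- `w` is the point at distance `i` from the base point on the geodesic to `y`. -/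
def At (y : Γ) (i : ℕ) (w : Γ) : Prop := M.d 1 w = i ∧ i + M.d w y = M.d 1 y

variable {M}

lemma exists_at {y : Γ} {i : ℕ} (hi : i ≤ M.d 1 y) : ∃ w, M.At y i w :=
  M.exists_between 1 y i hi

/-- Geodesics in a tree are unique. The case `i = j` says that `At` determines a vertex, though not
the group element representing it. -/
lemma At.dist {y w w' : Γ} {i j : ℕ} (hij : i ≤ j) (h : M.At y i w) (h' : M.At y j w') :
    i + M.d w w' = j := by
  obtain ⟨h1, h2⟩ := h
  obtain ⟨h3, h4⟩ := h'
  have h5 := M.four_point w 1 w' y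
  have h6 := M.triangle 1 w w'
  rw [M.d_comm w 1] at h5
  rw [M.d_comm w' y, M.d_comm y] at *
  omega

lemma At.τ_eq {y w w' : Γ} {i : ℕ} (h : M.At y i w) (h' : M.At y i w') : M.τ w = M.τ w' := by
  have := h.dist le_rfl h'
  exact M.τ_eq _ _ (by omega)

/-- A point between two points of a geodesic lies on it. -/
lemma At.of_between {y a b w : Γ} {i j p q : ℕ} (ha : M.At y i a) (hb : M.At y j b)
    (hp : M.d a w = p) (hq : M.d w b = q) (hpq : i + p + q = j) : M.At y (i + p) w := by
  obtain ⟨h1, h2⟩ := ha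
  obtain ⟨h3, h4⟩ := hb
  have h5 := M.triangle 1 a w
  have h6 := M.triangle w b y
  have h7 := M.triangle 1 w y
  constructor <;> omega

variable (M)

/-- If `g ^ k` lies on the geodesic from the base point to `y`, that geodesic starts with a
segment of length `α`, follows the axis of `g` along `k` periods of length `L`, and then passes
through the translate by `g ^ k` of the initial segment, reversed. -/
lemma exists_axis (g : Γ) (hτ : M.τ g ≠ 0) (k : ℕ) (hk : 0 < k) (y : Γ)
    (hy : M.d 1 (g ^ k) + M.d (g ^ k) y = M.d 1 y) :
    ∃ L α : ℕ, 0 < L ∧ M.d 1 (g ^ k) = k * L + 2 * α ∧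
      (∀ i w, α ≤ i → i + L ≤ α + k * L → M.At y i w → M.At y (i + L) (g * w)) ∧
      (∀ j w, j ≤ α → M.At y j w → M.At y (k * L + 2 * α - j) (g ^ k * w)) := by
  obtain ⟨z, L, hL, h1, h2, h4⟩ := M.exists_nearest_axis_point g hτ
  set α := M.d 1 z with hα
  have hN := h4 k hk
  have hat1 : M.At y 0 1 := ⟨M.d_self 1, by omega⟩
  have hatN : M.At y (k * L + 2 * α) (g ^ k) := ⟨hN, by omega⟩
  have hat : ∀ j, j ≤ k → M.At y (α + j * L) (g ^ j * z) := by
    intro j hj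
    obtain ⟨m, rfl⟩ := Nat.exists_eq_add_of_le hj
    have hd : M.d (g ^ j * z) (g ^ (j + m)) = α + m * L := by
      rw [pow_add, M.d_mul_left]
      rcases Nat.eq_zero_or_pos m with rfl | hm
      · simp [hα, M.d_comm]
      · exact h2 m hm
    have := At.of_between hat1 hatN (h1 j) hd (by rw [Nat.add_mul]; omega)
    rwa [zero_add] at this
  refine ⟨L, α, hL, hN, fun i w hi hi' hw => ?_, fun j w hj hw => ?_⟩
  · obtain ⟨m, rfl⟩ := Nat.exists_eq_succ_of_ne_zero hk.ne'
    have hz0 := hat 0 (Nat.zero_le _)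
    have hz1 := hat 1 (by omega)
    have hzm := hat m (by omega)
    have hzk := hat (m + 1) le_rfl
    simp only [pow_zero, one_mul, zero_mul, add_zero, pow_one] at hz0 hz1
    rw [Nat.succ_mul] at hi'
    have e1 := hz0.dist hi hw
    have e2 := hw.dist (by omega) hzm
    have := At.of_between (w := g * w) (p := i - α) (q := α + m * L - i) hz1 hzk
      (by rw [M.d_mul_left]; omega)
      (by rw [pow_succ', mul_assoc, M.d_mul_left]; omega) (by rw [Nat.succ_mul]; omega)
    convert this using 1
    omega
  -- `g ^ k` carries the approach from `1` to `z` onto the segment from `g ^ k` to `g ^ k * z`,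
  -- which the geodesic runs through backwards.
  · have hz0 := hat 0 (Nat.zero_le _)
    have hzk := hat k le_rfl
    simp only [pow_zero, one_mul, zero_mul, add_zero] at hz0
    have e1 := hw.dist hj hz0
    have := At.of_between (w := g ^ k * w) (p := α - j) (q := j) hzk hatN
      (by rw [M.d_mul_left, M.d_comm]; omega)
      (by
        have : M.d (g ^ k * w) (g ^ k * 1) = j := by
          rw [M.d_mul_left, M.d_comm]; exact hw.1
        rwa [mul_one] at this) (by omega)
    convert this using 1
    omega

/-- Two elements translating along a common geodesic of length greater than the sum of their
translation lengths commute. -/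
lemma commute_of_overlap {g h y : Γ} {L L' s e : ℕ}
    (hg : ∀ i w, s ≤ i → i + L ≤ e → M.At y i w → M.At y (i + L) (g * w))
    (hh : ∀ i w, s ≤ i → i + L' ≤ e → M.At y i w → M.At y (i + L') (h * w))
    (hse : s + L + L' + 1 ≤ e) (he : e ≤ M.d 1 y) : Commute g h := by
  have key : ∀ i w, s ≤ i → i + L + L' ≤ e → M.At y i w →
      M.d ((h * g)⁻¹ * (g * h) * w) w = 0 := by
    intro i w hi hi' hw
    have h1 := hg _ _ (by omega) (by omega) (hh i w hi (by omega) hw)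
    have h2 := hh _ _ (by omega) (by omega) (hg i w hi (by omega) hw)
    rw [Nat.add_right_comm] at h1
    have := h1.dist le_rfl h2
    rw [← M.d_mul_left (h * g), mul_assoc (h * g)⁻¹, mul_inv_cancel_left, mul_assoc, mul_assoc]
    omega
  -- The commutator must fix two adjacent vertices, `s` and `s + 1`; this is why the overlap exceeds
  -- `L + L'` by one.
  obtain ⟨w, hw⟩ := exists_at (M := M) (y := y) (i := s) (by omega)
  obtain ⟨w', hw'⟩ := exists_at (M := M) (y := y) (i := s + 1) (by omega)
  have hd := hw.dist (Nat.le_succ s) hw'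
  have := M.eq_one _ w w' (key s w le_rfl (by omega) hw) (key (s + 1) w' (by omega) (by omega) hw')
    (by omega)
  exact (inv_mul_eq_one.mp this).symm

/-- No element reverses a full period of the axis of an element `h` with `τ h ≠ 0`. -/
lemma false_of_reversed {r h y : Γ} {L s e α N : ℕ} (hτ : M.τ h ≠ 0)
    (hh : ∀ i w, s ≤ i → i + L ≤ e → M.At y i w → M.At y (i + L) (h * w))
    (hr : ∀ j w, j ≤ α → M.At y j w → M.At y (N - j) (r * w))
    (h1 : s + L ≤ α) (h2 : N + L ≤ e + α) (h3 : s + α ≤ N) (h4 : α ≤ e) (h5 : N ≤ M.d 1 y) :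
    False := by
  -- `r` reverses the period from `w` to `h * w`, so `h * (r * (h * w))` and `r * w` are the same
  -- vertex; comparing `τ` gives `2 * τ h = 0`.
  obtain ⟨w, hw⟩ := exists_at (M := M) (y := y) (i := α - L) (by omega)
  have hhw := hh _ _ (by omega) (by omega) hw
  rw [Nat.sub_add_cancel (by omega)] at hhw
  have hrw := hr _ _ (by omega) hw
  have hrhw := hr _ _ le_rfl hhw
  have hhr := hh _ _ (by omega) (by omega) hrhw
  rw [show N - α + L = N - (α - L) by omega] at hhr
  have := hrw.τ_eq hhr
  simp only [M.τ_mul] at this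
  omega

/-- An element whose displacement of the base point and `τ` equal one is not of the form `u ^ 5 * v ^ 4` with
`u`, `v` not commuting. -/
theorem commute_of_pow_mul_pow_eq {u v t : Γ} (ht : M.d 1 t = 1) (hτt : M.τ t = 1)
    (h : t = u ^ 5 * v ^ 4) : Commute u v := by
  have hτ : 5 * M.τ u + 4 * M.τ v = 1 := by
    rw [← hτt, h, M.τ_mul, M.τ_pow, M.τ_pow]; norm_num
  have hu : M.τ u⁻¹ ≠ 0 := by rw [M.τ_inv]; omega
  have hv : M.τ v ≠ 0 := by omega
  have hd : M.d (u⁻¹ ^ 5) (v ^ 4) = 1 := by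
    rw [← M.d_mul_left (u ^ 5), ← h, inv_pow, mul_inv_cancel, ht]
  have hpar : M.d 1 (u⁻¹ ^ 5) = M.d 1 (v ^ 4) + 1 ∨ M.d 1 (v ^ 4) = M.d 1 (u⁻¹ ^ 5) + 1 := by
    have p1 := M.parity 1 (u⁻¹ ^ 5)
    have p2 := M.parity 1 (v ^ 4)
    have p3 := M.parity (u⁻¹ ^ 5) (v ^ 4)
    have t1 := M.triangle 1 (u⁻¹ ^ 5) (v ^ 4)
    have t2 := M.triangle 1 (v ^ 4) (u⁻¹ ^ 5)
    rw [M.d_comm (v ^ 4) (u⁻¹ ^ 5)] at t2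
    omega
  -- `y` is the farther of the two points, so that both lie on a single geodesic.
  obtain ⟨y, hyu, hyv⟩ : ∃ y, M.d 1 (u⁻¹ ^ 5) + M.d (u⁻¹ ^ 5) y = M.d 1 y ∧
      M.d 1 (v ^ 4) + M.d (v ^ 4) y = M.d 1 y := by
    rcases hpar with hle | hle
    · exact ⟨u⁻¹ ^ 5, by rw [M.d_self, add_zero], by rw [M.d_comm (v ^ 4)]; omega⟩
    · exact ⟨v ^ 4, by omega, by rw [M.d_self, add_zero]⟩
  obtain ⟨L, α, hL, hN, hushift, hurev⟩ := M.exists_axis u⁻¹ hu 5 (by norm_num) y hyu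
  obtain ⟨L', β, hL', hN', hvshift, hvrev⟩ := M.exists_axis v hv 4 (by norm_num) y hyv
  -- The axis segment of `v` extends that of `u⁻¹` by a full period at both ends; `c2` swaps the
  -- roles.
  by_cases c1 : β + L' ≤ α ∧ 5 * L + α + L' ≤ 4 * L' + β
  · exact (M.false_of_reversed hv hvshift hurev (by omega) (by omega) (by omega) (by omega)
      (by omega)).elim
  by_cases c2 : α + L ≤ β ∧ 4 * L' + β + L ≤ 5 * L + α
  · exact (M.false_of_reversed hu hushift hvrev (by omega) (by omega) (by omega) (by omega)
      (by omega)).elim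
  -- Since `5 * L + 2 * α` and `4 * L' + 2 * β` differ by one, the axis segments are concentric up
  -- to half an edge. With `c1` and `c2` excluded, their intersection is long enough.
  have := M.commute_of_overlap (s := max α β) (e := min (α + 5 * L) (β + 4 * L'))
    (fun i w h1 h2 => hushift i w (by omega) (by omega))
    (fun i w h1 h2 => hvshift i w (by omega) (by omega)) (by omega) (by omega)
  exact Commute.inv_left_iff.mp this

end TreeMetric

/-! ### The tree of words, with distance read off from common prefixes. -/

namespace List

variable {A : Type*} [DecidableEq A]

/-- The length of the longest common prefix of two lists. -/
def lcpLength : List A → List A → ℕ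
  | a :: l, b :: m => if a = b then lcpLength l m + 1 else 0
  | _, _ => 0

lemma lcpLength_self (l : List A) : lcpLength l l = l.length := by
  induction l with
  | nil => rfl
  | cons a l ih => simp [lcpLength, ih]

lemma lcpLength_comm (l m : List A) : lcpLength l m = lcpLength m l := by
  induction l generalizing m with
  | nil => cases m <;> rfl
  | cons a l ih =>
    cases m with
    | nil => rfl
    | cons b m =>
      by_cases h : a = b
      · simp [lcpLength, h, ih]
      · simp [lcpLength, h, Ne.symm h]

lemma lcpLength_le_left (l m : List A) : lcpLength l m ≤ l.length := by
  induction l generalizing m with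
  | nil => cases m <;> simp [lcpLength]
  | cons a l ih =>
    cases m with
    | nil => simp [lcpLength]
    | cons b m =>
      have := ih m
      by_cases h : a = b <;> simp [lcpLength, h, this]

lemma lcpLength_le_right (l m : List A) : lcpLength l m ≤ m.length := by
  rw [lcpLength_comm]
  exact lcpLength_le_left m l

lemma lcpLength_ultra (l m n : List A) :
    lcpLength l m ≤ lcpLength l n ∨ lcpLength m n ≤ lcpLength l n := by
  induction l generalizing m n with
  | nil => left; cases m <;> simp [lcpLength]
  | cons a l ih =>
    rcases m with _ | ⟨b, m⟩
    · simp [lcpLength]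
    rcases n with _ | ⟨c, n⟩
    · simp [lcpLength]
    by_cases hab : a = b
    · by_cases hbc : b = c
      · subst hab hbc
        simpa [lcpLength] using ih m n
      · simp [lcpLength, hbc]
    · simp [lcpLength, hab]

lemma lcpLength_eq_zero {l m : List A} {a : A} (hl : l.head? = some a) (hm : m.head? ≠ some a) :
    lcpLength l m = 0 := by
  rcases l with _ | ⟨b, l⟩
  · simp at hl
  rcases m with _ | ⟨c, m⟩
  · rfl
  have : b ≠ c := by
    rintro rfl
    simp_all
  simp [lcpLength, this]

/-- The distance between two lists in the tree in which every list `l` is joined to the lists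
extending it by one last letter. -/
def treeDist (l m : List A) : ℕ := l.length + m.length - 2 * lcpLength l m

lemma treeDist_add (l m : List A) :
    treeDist l m + 2 * lcpLength l m = l.length + m.length := by
  have h1 := lcpLength_le_left l m
  have h2 := lcpLength_le_right l m
  unfold treeDist
  omega

lemma treeDist_comm (l m : List A) : treeDist l m = treeDist m l := by
  rw [treeDist, treeDist, lcpLength_comm, add_comm]

lemma treeDist_self (l : List A) : treeDist l l = 0 := by
  rw [treeDist, lcpLength_self]; omega

lemma treeDist_nil_left (l : List A) : treeDist [] l = l.length := by
  simp [treeDist, lcpLength]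

lemma treeDist_cons_cons (a : A) (l m : List A) : treeDist (a :: l) (a :: m) = treeDist l m := by
  have h1 := treeDist_add l m
  have h2 := treeDist_add (a :: l) (a :: m)
  simp [lcpLength] at h2
  omega

/-- `lcpLength` is the Gromov product at the empty word, so the ultrametric inequality for it is the
four-point condition. -/
lemma treeDist_four_point (x y z w : List A) :
    treeDist x z + treeDist y w ≤ treeDist x y + treeDist z w ∨
    treeDist x z + treeDist y w ≤ treeDist x w + treeDist y z := by
  have a1 := treeDist_add x y
  have a2 := treeDist_add x z
  have a3 := treeDist_add x w
  have a4 := treeDist_add y z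
  have a5 := treeDist_add y w
  have a6 := treeDist_add z w
  have key : lcpLength x y + lcpLength z w ≤ lcpLength x z + lcpLength y w ∨
      lcpLength x w + lcpLength y z ≤ lcpLength x z + lcpLength y w := by
    have u1 := lcpLength_ultra x y z
    have u2 := lcpLength_ultra x w z
    have u3 := lcpLength_ultra y x w
    have u4 := lcpLength_ultra y z w
    rw [lcpLength_comm y x] at u3
    rw [lcpLength_comm w z] at u2
    omega
  omega

lemma eq_of_treeDist_eq_zero {l m : List A} (h : treeDist l m = 0) : l = m := by
  induction l generalizing m with
  | nil =>
    rw [treeDist_nil_left] at h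
    exact (List.length_eq_zero_iff.mp h).symm
  | cons a l ih =>
    rcases m with _ | ⟨b, m⟩
    · rw [treeDist_comm, treeDist_nil_left] at h
      simp at h
    by_cases hab : a = b
    · subst hab
      rw [treeDist_cons_cons] at h
      rw [ih h]
    · simp [treeDist, lcpLength, hab] at h

lemma treeDist_take (l : List A) (i : ℕ) (hi : i ≤ l.length) :
    treeDist (l.take i) l + i = l.length := by
  induction l generalizing i with
  | nil => simp at hi; subst hi; rfl
  | cons a l ih =>
    rcases i with _ | i
    · simp [treeDist_nil_left]
    · have := ih i (by simpa using hi)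
      rw [List.take_succ_cons, treeDist_cons_cons, List.length_cons]
      omega

end List

/-! ### The Bass–Serre tree of `H * ⟨t⟩` and the action on it. -/

namespace FreeProductTree

open List Monoid

variable (H : Type*) [Group H]

/-- The vertices of the tree: reduced words `h₁ t^{e₁} ⋯ hₙ t^{eₙ}`, encoded as lists of pairs;
they represent the cosets of `H` in `H * ⟨t⟩`. -/
abbrev Vertex : Type _ :=
  {l : List (H × Bool) // l.IsChain fun p q => q ≠ (1, !p.2)}

variable {H}

namespace Vertex

lemma tail_chain {l : List (H × Bool)} (h : l.IsChain fun p q => q ≠ (1, !p.2)) :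
    l.tail.IsChain fun p q => q ≠ (1, !p.2) := by
  cases l with
  | nil => exact h
  | cons a l => exact (List.isChain_cons.mp h).2

/-- Left multiplication of a word by an element of `H`. -/
def smulList (h : H) : List (H × Bool) → List (H × Bool)
  | [] => []
  | a :: l => (h * a.1, a.2) :: l

lemma smulList_chain (h : H) {l : List (H × Bool)}
    (hl : l.IsChain fun p q => q ≠ (1, !p.2)) :
    (smulList h l).IsChain fun p q => q ≠ (1, !p.2) := by
  cases l with
  | nil => exact hl
  | cons a l => exact List.isChain_cons.mpr (List.isChain_cons.mp hl)

open Classical in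
/-- Left multiplication of a word by `t` (for `b = true`) or by `t⁻¹` (for `b = false`). -/
noncomputable def stepList (b : Bool) (l : List (H × Bool)) : List (H × Bool) :=
  if l.head? = some (1, !b) then l.tail else (1, b) :: l

lemma stepList_chain (b : Bool) {l : List (H × Bool)}
    (hl : l.IsChain fun p q => q ≠ (1, !p.2)) :
    (stepList b l).IsChain fun p q => q ≠ (1, !p.2) := by
  unfold stepList
  split_ifs with h
  · exact tail_chain hl
  · refine List.isChain_cons.mpr ⟨fun q hq hq' => h ?_, hl⟩
    rw [Option.mem_def] at hq
    rw [hq, hq']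

lemma stepList_stepList (b : Bool) {l : List (H × Bool)}
    (hl : l.IsChain fun p q => q ≠ (1, !p.2)) : stepList (!b) (stepList b l) = l := by
  by_cases h : l.head? = some (1, !b)
  · rcases l with _ | ⟨a, l⟩
    · simp at h
    obtain rfl : a = (1, !b) := by simpa using h
    have h1 := (List.isChain_cons.mp hl).1
    have h2 : l.head? ≠ some (1, b) := fun h' => h1 _ h' (by simp)
    simp [stepList, h2]
  · simp [stepList, h]

open Classical in
lemma treeDist_smulList (h : H) (l m : List (H × Bool)) :
    treeDist (smulList h l) (smulList h m) = treeDist l m := by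
  have hlen : ∀ l, (smulList h l).length = l.length := by
    intro l; cases l <;> rfl
  have hlcp : lcpLength (smulList h l) (smulList h m) = lcpLength l m := by
    rcases l with _ | ⟨a, l⟩
    · cases m <;> rfl
    rcases m with _ | ⟨b, m⟩
    · rfl
    simp [smulList, lcpLength, Prod.ext_iff]
  rw [treeDist, treeDist, hlen, hlen, hlcp]

-- In the mixed case one word loses a letter and the other gains one, while the common prefix is
-- empty before and after.
open Classical in
lemma treeDist_stepList_of_head {b : Bool} {l m : List (H × Bool)}
    (hl : l.IsChain fun p q => q ≠ (1, !p.2))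
    (h : l.head? = some (1, !b)) (h' : m.head? ≠ some (1, !b)) :
    treeDist (stepList b l) (stepList b m) = treeDist l m := by
  have h0 := lcpLength_eq_zero h h'
  rcases l with _ | ⟨a, l⟩
  · simp at h
  obtain rfl : a = (1, !b) := by simpa using h
  have h1 := (List.isChain_cons.mp hl).1
  have h2 : l.head? ≠ some (1, b) := fun h' => h1 _ h' (by simp)
  have h3 : lcpLength ((1, b) :: m) l = 0 := lcpLength_eq_zero (by simp) h2
  have h4 : stepList b ((1, !b) :: l) = l := by simp [stepList]
  have h5 : stepList b m = (1, b) :: m := by simp [stepList, h']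
  rw [h4, h5, treeDist, treeDist, h0, lcpLength_comm, h3]
  simp only [List.length_cons]
  omega

open Classical in
lemma treeDist_stepList (b : Bool) {l m : List (H × Bool)}
    (hl : l.IsChain fun p q => q ≠ (1, !p.2)) (hm : m.IsChain fun p q => q ≠ (1, !p.2)) :
    treeDist (stepList b l) (stepList b m) = treeDist l m := by
  by_cases h : l.head? = some (1, !b)
  · by_cases h' : m.head? = some (1, !b)
    · rcases l with _ | ⟨a, l⟩
      · simp at h
      rcases m with _ | ⟨c, m⟩
      · simp at h'
      obtain rfl : a = (1, !b) := by simpa using h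
      obtain rfl : c = (1, !b) := by simpa using h'
      simp [stepList, treeDist_cons_cons]
    · exact treeDist_stepList_of_head hl h h'
  · by_cases h' : m.head? = some (1, !b)
    · rw [treeDist_comm, treeDist_stepList_of_head hm h' h, treeDist_comm]
    · simp [stepList, h, h', treeDist_cons_cons]

/-- The permutation of the vertices given by an element of `H`. -/
def smulPerm : H →* Equiv.Perm (Vertex H) :=
  MonoidHom.toHomPerm
    { toFun := fun h x => ⟨smulList h x.1, smulList_chain h x.2⟩
      map_one' := by
        funext ⟨l, hl⟩
        apply Subtype.ext
        change smulList 1 l = l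
        cases l <;> simp [smulList]
      map_mul' := by
        intro g h
        funext ⟨l, hl⟩
        apply Subtype.ext
        change smulList (g * h) l = smulList g (smulList h l)
        cases l <;> simp [smulList, mul_assoc] }

/-- The permutation of the vertices given by `t`. -/
noncomputable def stepPerm : Equiv.Perm (Vertex H) where
  toFun x := ⟨stepList true x.1, stepList_chain true x.2⟩
  invFun x := ⟨stepList false x.1, stepList_chain false x.2⟩
  left_inv x := Subtype.ext (stepList_stepList true x.2)
  right_inv x := Subtype.ext (stepList_stepList false x.2)

end Vertex

open Vertex

/-- The action of `H * ⟨t⟩` on the tree. -/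
noncomputable def act : Coprod H (Multiplicative ℤ) →* Equiv.Perm (Vertex H) :=
  Coprod.lift smulPerm (zpowersHom _ stepPerm)

/-- The generator `t`. -/
def t : Coprod H (Multiplicative ℤ) := Coprod.inr (Multiplicative.ofAdd 1)

/-- The base vertex. -/
def base : Vertex H := ⟨[], List.isChain_nil⟩

lemma act_inl (h : H) (x : Vertex H) : (act (Coprod.inl h) x).1 = smulList h x.1 := by
  rw [act, Coprod.lift_apply_inl]
  rfl

lemma act_t (x : Vertex H) : (act t x).1 = stepList true x.1 := by
  simp only [act, t, Coprod.lift_apply_inr, zpowersHom_apply, toAdd_ofAdd, zpow_one]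
  rfl

lemma act_t_inv (x : Vertex H) : (act t⁻¹ x).1 = stepList false x.1 := by
  rw [map_inv]
  simp only [act, t, Coprod.lift_apply_inr, zpowersHom_apply, toAdd_ofAdd, zpow_one]
  rfl

/-- The element `t` (for `true`) or `t⁻¹` (for `false`). -/
def tb (b : Bool) : Coprod H (Multiplicative ℤ) := cond b t t⁻¹

lemma act_tb (b : Bool) (x : Vertex H) : (act (tb b) x).1 = stepList b x.1 := by
  cases b
  · exact act_t_inv x
  · exact act_t x

lemma tb_not (b : Bool) : (tb (!b) : Coprod H (Multiplicative ℤ)) = (tb b)⁻¹ := by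
  cases b <;> simp [tb]

/-- Induction on elements of `H * ⟨t⟩` by left multiplication with generators. -/
lemma induction_left {P : Coprod H (Multiplicative ℤ) → Prop} (one : P 1)
    (inl : ∀ h g, P g → P (Coprod.inl h * g)) (tb : ∀ b g, P g → P (tb b * g))
    (g : Coprod H (Multiplicative ℤ)) : P g := by
  have key : ∀ (n : ℕ) (b : Bool) g, P g → P (FreeProductTree.tb b ^ n * g) := by
    intro n b
    induction n with
    | zero => intro g hg; simpa using hg
    | succ n ih =>
      intro g hg
      rw [pow_succ', mul_assoc]
      exact tb _ _ (ih g hg)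
  have hgen : ∀ x g, P g → P (x * g) := by
    intro x
    induction x using Coprod.induction_on with
    | inl h => exact inl h
    | inr z =>
      intro g hg
      have hz : (Coprod.inr z : Coprod H (Multiplicative ℤ)) = t ^ (Multiplicative.toAdd z) := by
        rw [t, ← map_zpow, ← ofAdd_zsmul]
        simp
      rw [hz]
      rcases Int.eq_nat_or_neg (Multiplicative.toAdd z) with ⟨n, hn | hn⟩
      · rw [hn, zpow_natCast]
        exact key n true g hg
      · rw [hn, zpow_neg, zpow_natCast, ← inv_pow]
        exact key n false g hg
    | mul x y hx hy =>
      intro g hg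
      rw [mul_assoc]
      exact hx _ (hy _ hg)
  simpa using hgen g 1 one

open Classical in
lemma treeDist_act (g : Coprod H (Multiplicative ℤ)) (x y : Vertex H) :
    treeDist (act g x).1 (act g y).1 = treeDist x.1 y.1 := by
  induction g using induction_left with
  | one => simp
  | inl h g ih => rw [map_mul, Equiv.Perm.mul_apply, Equiv.Perm.mul_apply, act_inl, act_inl,
      treeDist_smulList, ih]
  | tb b g ih => rw [map_mul, Equiv.Perm.mul_apply, Equiv.Perm.mul_apply, act_tb, act_tb,
      treeDist_stepList b (act g x).2 (act g y).2, ih]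

/-- The element of `H * ⟨t⟩` spelled by a word. -/
def spell : List (H × Bool) → Coprod H (Multiplicative ℤ)
  | [] => 1
  | a :: l => Coprod.inl a.1 * tb a.2 * spell l

lemma spell_stepList (b : Bool) (l : List (H × Bool)) :
    spell (stepList b l) = tb b * spell l := by
  by_cases h : l.head? = some (1, !b)
  · rcases l with _ | ⟨a, l⟩
    · simp at h
    obtain rfl : a = (1, !b) := by simpa using h
    simp [stepList, spell, tb_not]
  · simp [stepList, h, spell]

/-- Because the word is reduced, no step of the spelling cancels. In particular the action is
transitive on vertices. -/
lemma act_spell_base (x : Vertex H) : act (spell x.1) base = x := by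
  obtain ⟨l, hl⟩ := x
  induction l with
  | nil => simp [spell, base]
  | cons a l ih =>
    obtain ⟨h1, h2⟩ := List.isChain_cons.mp hl
    have h3 : l.head? ≠ some (1, !a.2) := fun h' => h1 _ h' rfl
    apply Subtype.ext
    simp only [spell, map_mul, Equiv.Perm.mul_apply] at ih ⊢
    rw [act_inl, act_tb, ih h2]
    simp [stepList, h3, smulList]

/-- Every element is the word spelling its vertex times an element of `H`. -/
lemma exists_eq_spell_mul (g : Coprod H (Multiplicative ℤ)) :
    ∃ h : H, g = spell (act g base).1 * Coprod.inl h := by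
  induction g using induction_left with
  | one => exact ⟨1, by simp [spell, base]⟩
  | inl k g ih =>
    obtain ⟨h, hh⟩ := ih
    rw [map_mul, Equiv.Perm.mul_apply, act_inl]
    rcases hl : (act g base).1 with _ | ⟨a, l⟩
    · rw [hl] at hh
      exact ⟨k * h, by rw [hh]; simp [smulList, spell]⟩
    · rw [hl] at hh
      exact ⟨h, by conv_lhs => rw [hh]
                   simp [smulList, spell, mul_assoc]⟩
  | tb b g ih =>
    obtain ⟨h, hh⟩ := ih
    refine ⟨h, ?_⟩
    rw [map_mul, Equiv.Perm.mul_apply, act_tb, spell_stepList, mul_assoc, ← hh]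

/-- The exponent sum of `t`. -/
def expSum : Coprod H (Multiplicative ℤ) →* Multiplicative ℤ :=
  Coprod.lift 1 (MonoidHom.id _)

lemma expSum_inl (h : H) : expSum (Coprod.inl h) = 1 := by simp [expSum]

lemma expSum_t : expSum (t : Coprod H (Multiplicative ℤ)) = Multiplicative.ofAdd 1 := by
  simp [expSum, t]

lemma length_parity (g : Coprod H (Multiplicative ℤ)) :
    (((act g base).1.length : ℤ) - Multiplicative.toAdd (expSum g)) % 2 = 0 := by
  induction g using induction_left with
  | one => simp [base]
  | inl h g ih =>
    rw [map_mul, Equiv.Perm.mul_apply, act_inl, map_mul, expSum_inl, one_mul]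
    rcases hl : (act g base).1 with _ | ⟨a, l⟩ <;> rw [hl] at ih <;> simpa [smulList] using ih
  | tb b g ih =>
    rw [map_mul, Equiv.Perm.mul_apply, act_tb, map_mul, toAdd_mul]
    have h1 : Multiplicative.toAdd (expSum (tb b : Coprod H (Multiplicative ℤ))) = 1 ∨
        Multiplicative.toAdd (expSum (tb b : Coprod H (Multiplicative ℤ))) = -1 := by
      cases b <;> simp [tb, expSum_t]
    have h2 : (stepList b (act g base).1).length = (act g base).1.length + 1 ∨
        (stepList b (act g base).1).length + 1 = (act g base).1.length := by
      unfold stepList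
      split_ifs with h
      · rcases hl : (act g base).1 with _ | ⟨a, l⟩
        · simp [hl] at h
        · simp
      · simp
    omega

lemma mem_range_inl_of_act_base {g : Coprod H (Multiplicative ℤ)} (hg : act g base = base) :
    ∃ h : H, g = Coprod.inl h := by
  obtain ⟨h, hh⟩ := exists_eq_spell_mul g
  exact ⟨h, by rw [hh, hg]; simp [base, spell]⟩

/-- The stabiliser of two distinct vertices is trivial. -/
lemma eq_one_of_fix {g : Coprod H (Multiplicative ℤ)} {x y : Vertex H} (hx : act g x = x)
    (hy : act g y = y) (hxy : x ≠ y) : g = 1 := by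
  set k := spell x.1
  have hk : act k base = x := act_spell_base x
  -- Conjugation by `k` moves `x` to the base vertex, so `g` becomes some `h` in `H`; this
  -- multiplies the first letter of any nonempty word by `h`, so a second fixed vertex forces `h =
  -- 1`.
  have hk' : act k⁻¹ x = base := by rw [map_inv, Equiv.Perm.inv_eq_iff_eq, hk]
  obtain ⟨h, hh⟩ := mem_range_inl_of_act_base (g := k⁻¹ * g * k) (by
    simp only [map_mul, Equiv.Perm.mul_apply]; rw [hk, hx, hk'])
  have hfix : act (Coprod.inl h) (act k⁻¹ y) = act k⁻¹ y := by
    rw [← hh]; simp [hy]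
  have hne : (act k⁻¹ y).1 ≠ [] := by
    intro h0
    have h1 : act k⁻¹ y = act k⁻¹ x := by rw [hk']; exact Subtype.ext h0
    exact hxy ((act k⁻¹).injective h1).symm
  have h1 := congrArg Subtype.val hfix
  rw [act_inl] at h1
  rcases hl : (act k⁻¹ y).1 with _ | ⟨a, l⟩
  · exact absurd hl hne
  rw [hl] at h1
  have h2 : h = 1 := by simpa [smulList, Prod.ext_iff] using h1
  rw [h2, map_one] at hh
  have h3 : g = k * (k⁻¹ * g * k) * k⁻¹ := by group
  rw [h3, hh]; simp

open Classical in
/-- The tree metric on `H * ⟨t⟩`. -/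
noncomputable def treeMetric : TreeMetric (Coprod H (Multiplicative ℤ)) where
  d x y := treeDist (act x base).1 (act y base).1
  τ x := Multiplicative.toAdd (expSum x)
  d_self x := treeDist_self _
  d_comm x y := treeDist_comm _ _
  d_mul_left g x y := by
    rw [map_mul, map_mul, Equiv.Perm.mul_apply, Equiv.Perm.mul_apply, treeDist_act]
  four_point x y z w := treeDist_four_point _ _ _ _
  exists_between x y i hi := by
    have h0 : ∀ z, treeDist (act x base).1 (act z base).1 = (act (x⁻¹ * z) base).1.length := by
      intro z
      rw [← treeDist_act x⁻¹, ← Equiv.Perm.mul_apply, ← map_mul, ← Equiv.Perm.mul_apply,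
        ← map_mul, inv_mul_cancel, map_one]
      exact treeDist_nil_left _
    rw [h0] at hi
    set v := act (x⁻¹ * y) base with hv
    -- After moving `x` to the root, the geodesic to a word runs through its prefixes.
    let w : Vertex H := ⟨v.1.take i, v.2.take i⟩
    refine ⟨x * spell w.1, ?_, ?_⟩
    · rw [h0, inv_mul_cancel_left, act_spell_base]
      simpa [w] using hi
    · rw [h0, ← treeDist_act x⁻¹, ← Equiv.Perm.mul_apply, ← map_mul, ← Equiv.Perm.mul_apply,
        ← map_mul, inv_mul_cancel_left, act_spell_base, ← hv]
      have := treeDist_take v.1 i hi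
      change i + treeDist (v.1.take i) v.1 = v.1.length
      omega
  eq_one g x y hx hy hxy := by
    rw [map_mul, Equiv.Perm.mul_apply] at hx hy
    refine eq_one_of_fix (Subtype.ext (eq_of_treeDist_eq_zero hx))
      (Subtype.ext (eq_of_treeDist_eq_zero hy)) fun h => hxy ?_
    rw [h, treeDist_self]
  τ_mul x y := by rw [map_mul, toAdd_mul]
  parity x y := by
    have h1 := length_parity x
    have h2 := length_parity y
    have h3 := treeDist_add (act x base).1 (act y base).1
    omega
  τ_eq x y h := by
    have h1 : act x base = act y base := Subtype.ext (eq_of_treeDist_eq_zero h)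
    obtain ⟨a, ha⟩ := exists_eq_spell_mul x
    obtain ⟨b, hb⟩ := exists_eq_spell_mul y
    rw [ha, hb, h1, map_mul expSum, map_mul expSum, expSum_inl, expSum_inl]

/-- In `H * ⟨t⟩` the generator `t` is not of the form `u ^ 5 * v ^ 4` with `u`, `v` not
commuting. -/
theorem commute_of_t_eq {u v : Coprod H (Multiplicative ℤ)} (h : t = u ^ 5 * v ^ 4) :
    Commute u v := by
  refine treeMetric.commute_of_pow_mul_pow_eq (t := t) ?_ ?_ h
  · classical
    change treeDist (act 1 base).1 (act t base).1 = 1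
    rw [act_t, map_one]
    exact (treeDist_nil_left _).trans (by simp [base, stepList])
  · change Multiplicative.toAdd (expSum t) = 1
    rw [expSum_t]; rfl

end FreeProductTree

/-! ### Reduction of primitive elements to the generator `t`. -/

namespace FreeProductTree

open Monoid

/-- If `Γ * ⟨t⟩` retracts onto `Γ` by `t ↦ e`, with a section sending `e` to `t`, then
`e` is not of the form `u ^ 5 * v ^ 4` with `u`, `v` not commuting. -/
lemma ne_pow_mul_pow {Γ : Type*} [Group Γ] {e : Γ} (j : Γ →* Coprod Γ (Multiplicative ℤ))
    (hj : (Coprod.lift (MonoidHom.id Γ) (zpowersHom Γ e)).comp j = MonoidHom.id Γ)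
    (he : j e = t) (u v : Γ) (huv : ⁅u, v⁆ ≠ 1) : e ≠ u ^ 5 * v ^ 4 := by
  intro h
  have hinj : Function.Injective j :=
    Function.LeftInverse.injective (g := Coprod.lift (MonoidHom.id Γ) (zpowersHom Γ e))
      fun x => DFunLike.congr_fun hj x
  have hc : Commute (j u) (j v) := commute_of_t_eq (by rw [← he, h, map_mul, map_pow, map_pow])
  refine huv (commutatorElement_eq_one_iff_mul_comm.mpr (hinj ?_))
  rw [map_mul, map_mul]
  exact hc

/-- The product of a member of a basis of a free factor and an element of the subgroup generated
by the other members is not of the form `u ^ 5 * v ^ 4` with `u`, `v` not commuting. -/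
lemma inr_basis_mul_ne {G F ι : Type*} [Group G] [Group F] (B : FreeGroupBasis ι F) (i : ι)
    {c : F} (hc : c ∈ Subgroup.closure (B '' {k | k ≠ i})) (u v : Coprod G F)
    (huv : ⁅u, v⁆ ≠ 1) : (Coprod.inr (B i * c) : Coprod G F) ≠ u ^ 5 * v ^ 4 := by
  classical
  let c' : Coprod (Coprod G F) (Multiplicative ℤ) := Coprod.inl (Coprod.inr c)
  -- Only `B i` is altered, so `c` is kept and `B i * c` goes to `t`; sending `t` back to `B i * c`
  -- undoes this.
  let jF : F →* Coprod (Coprod G F) (Multiplicative ℤ) :=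
    B.lift fun k => if k = i then t * c'⁻¹ else Coprod.inl (Coprod.inr (B k))
  have hjF : ∀ k, jF (B k) = if k = i then t * c'⁻¹ else Coprod.inl (Coprod.inr (B k)) :=
    fun k => by simp [jF, FreeGroupBasis.lift]
  have hjc : jF c = c' := by
    refine MonoidHom.eqOn_closure (f := jF)
      (g := (Coprod.inl : Coprod G F →* Coprod (Coprod G F) (Multiplicative ℤ)).comp Coprod.inr)
      ?_ hc
    rintro _ ⟨k, hk, rfl⟩
    rw [hjF, if_neg hk]
    rfl
  refine ne_pow_mul_pow (Coprod.lift (Coprod.inl.comp Coprod.inl) jF) ?_ ?_ u v huv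
  · refine Coprod.hom_ext ?_ (B.ext_hom _ _ fun k => ?_)
    · ext g
      simp
    · by_cases hk : k = i
      · subst hk
        simp [hjF, c', t]
      · simp [hjF, hk]
  · rw [Coprod.lift_apply_inr, map_mul, hjc, hjF, if_pos rfl, inv_mul_cancel_right]

end FreeProductTree

theorem mainTheorem6 (G₁ G₂ : Type*) [Group G₁] [Group G₂] [Nontrivial G₁] [Nontrivial G₂]
    (hne : ¬ (Nonempty (G₁ ≃* Multiplicative (ZMod 2)) ∧
      Nonempty (G₂ ≃* Multiplicative (ZMod 2)))) :
    (∀ a b : NonEq.FOmega, NonEq.IsPartOfBasis a b →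
      NonEq.phiNE.Realize
        (![Monoid.Coprod.inr a, Monoid.Coprod.inr b] :
          Fin 2 → Monoid.Coprod (Monoid.Coprod G₁ G₂) NonEq.FOmega)) ∧
    (∀ u v : Monoid.Coprod (Monoid.Coprod G₁ G₂) NonEq.FOmega,
      ⁅u, v⁆ ≠ 1 → Monoid.Coprod.inr NonEq.e₁ ≠ u ^ 5 * v ^ 4) := by
  refine ⟨?_, fun u v huv => ?_⟩
  · rintro a b ⟨S, B, hB, ha, hb, hab⟩
    rw [NonEq.realize_phiNE]
    intro u v huv
    -- Here `c = b` is itself another basis member; for `e₁` below, `c = 1`.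
    have := FreeProductTree.inr_basis_mul_ne (G := Monoid.Coprod G₁ G₂) B ⟨a, ha⟩ (c := b)
      (Subgroup.subset_closure ⟨⟨b, hb⟩, fun h => hab (congrArg Subtype.val h).symm, hB _⟩)
      u v huv
    rwa [hB, map_mul] at this
  · have := FreeProductTree.inr_basis_mul_ne (G := Monoid.Coprod G₁ G₂)
      (FreeGroupBasis.ofFreeGroup ℕ) 0 (one_mem _) u v huv
    rwa [mul_one] at this
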